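/- For $\alpha\in(0,1/2)$ let $\Gamma_\alpha=\{\sum_{i\ge1}\epsilon_i\alpha^i:\epsilon_i\in\{0,1\}\}$. A sequence $(t_i)_{i\ge1}\in\{-1,0,1\}^{\mathbb N}$ is an $\alpha$-expansion of $t\in\mathbb R$ if $t=\sum_{i\ge1}t_i\alpha^i$. Let $\mathcal U_\alpha$ be the set of $t\in\Gamma_\alpha-\Gamma_\alpha$ that have exactly one such $\alpha$-expansion, and let $$D_\alpha=\{\dim_H(\Gamma_\alpha\cap(\Gamma_\alpha+t)):t\in\mathcal U_\alpha\}.$$ 1. If $\alpha\in\left(\frac13,\frac{3-\sqrt5}2\right]$, then $D_\alpha=\left[0,\frac{\log2}{-\log\alpha}\right]$. 2. If $\alpha\in\left(\frac{3-\sqrt5}2,\frac12\right)$, then $D_\alpha$ is a proper subset of $\left[0,\frac{\log2}{-\log\alpha}\right]$. Moreover, there is $\delta>0$ (depending on $\alpha$) such that no unique $\alpha$-expansion $(t_i)$ of a point of $\mathcal U_\alpha$ has lower zero-frequency $$\liminf_{n\to\infty}\frac{\#\{1\le i\le n:t_i=0\}}n\in(1-\delta,1).$$ -/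

import Mathlib

open scoped Pointwise

noncomputable section

/-- `IsExpansion A α d x`: the digit sequence `d` (indexed from `0`, so that `d i` is the coefficient
of `α ^ (i + 1)`) has all its digits in the alphabet `A` and `x = ∑ i, d i * α ^ (i + 1)`. -/
def IsExpansion (A : Set ℤ) (α : ℝ) (d : ℕ → ℤ) (x : ℝ) : Prop :=
  (∀ i, d i ∈ A) ∧ HasSum (fun i : ℕ => (d i : ℝ) * α ^ (i + 1)) x

/-- The Cantor set `Γ_α` of all sums `∑_{i ≥ 1} ε_i α ^ i` with digits `ε_i ∈ {0, 1}`. -/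
def cantorGamma (α : ℝ) : Set ℝ :=
  {x | ∃ d : ℕ → ℤ, IsExpansion {0, 1} α d x}

/-- The points of `Γ_α - Γ_α` with a unique `α`-expansion over the alphabet `{-1, 0, 1}`. -/
def univoqueSet (α : ℝ) : Set ℝ :=
  {t | t ∈ cantorGamma α - cantorGamma α ∧ ∃! d : ℕ → ℤ, IsExpansion {-1, 0, 1} α d t}

/-- The unique `α`-expansions over `{-1, 0, 1}` of the points of `univoqueSet α`. -/
def univoqueSeq (α : ℝ) : Set (ℕ → ℤ) :=
  {d | ∃ t ∈ univoqueSet α, IsExpansion {-1, 0, 1} α d t}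

/-- The set `D_α` of the Hausdorff dimensions of `Γ_α ∩ (Γ_α + t)`, where `t` has a unique
`{-1, 0, 1}`-expansion. -/
def dimSet (α : ℝ) : Set ENNReal :=
  {s | ∃ t ∈ univoqueSet α, s = dimH (cantorGamma α ∩ (fun x => x + t) '' cantorGamma α)}

/-- The lower frequency of the digit `0` in a digit sequence. -/
def lowerZeroFreq (d : ℕ → ℤ) : ℝ :=
  Filter.liminf
    (fun n : ℕ => (((Finset.range n).filter (fun i => d i = 0)).card : ℝ) / (n : ℝ)) Filter.atTop

end

/-! ### Digit sums: tails, separation, greedy expansions -/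

section DigitSums

/-! Write M = α/(1-α) for the largest value of a digit sum.

If t has the unique expansion d, then Γ ∩ (Γ+t) consists of the sums of binary sequences that are
forced where d is nonzero and free where d is zero (`cantorGamma_inter_translate`). Counting
cylinders bounds its dimension above; reading the free digits in base 2 gives a Hölder map onto
[0,1] and bounds it below. So the dimension is the lower zero-frequency of d times log 2 / (-log α)
(`dimH_image_overlapDigits`), and the question is which frequencies unique expansions attain.

Uniqueness is governed by tails: if all tails are below 1 - M in absolute value, d is unique; for α
≥ 1/3, in a unique d every tail following a digit ≤ 0 is below 1 - M. Tails of the sequences with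
alternating signs used here are below α, and α ≤ 1 - M means α ≤ (3-√5)/2; such sequences realise
every frequency (`dimSet_eq_Icc`). If α > 1 - M, a 1 preceded by a digit ≤ 0 needs a tail negative
by a definite amount, hence another nonzero digit within K places. This repeats forever and keeps
the zero-frequency away from 1, apart from sequences that end in zeros (`exists_gap_lowerZeroFreq`).
-/

/-- The value `∑ i, d i * α ^ (i + 1)` of a digit sequence. -/
noncomputable def digitSum (α : ℝ) (d : ℕ → ℤ) : ℝ := ∑' i, (d i : ℝ) * α ^ (i + 1)

variable {α : ℝ} {d e : ℕ → ℤ}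

theorem hasSum_one_digits (h0 : 0 ≤ α) (h1 : α < 1) :
    HasSum (fun i : ℕ => α ^ (i + 1)) (α / (1 - α)) := by
  simpa [pow_succ', div_eq_mul_inv] using (hasSum_geometric_of_lt_one h0 h1).mul_left α

theorem abs_digit_mul_pow_le (h0 : 0 ≤ α) (hd : ∀ i, |d i| ≤ 1) (i : ℕ) :
    |(d i : ℝ) * α ^ (i + 1)| ≤ α ^ (i + 1) := by
  have h : |(d i : ℝ)| ≤ 1 := by exact_mod_cast hd i
  rw [abs_mul, abs_of_nonneg (pow_nonneg h0 (i + 1))]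
  exact mul_le_of_le_one_left (by positivity) h

theorem summable_digits (h0 : 0 ≤ α) (h1 : α < 1) (hd : ∀ i, |d i| ≤ 1) :
    Summable (fun i : ℕ => (d i : ℝ) * α ^ (i + 1)) :=
  .of_norm_bounded (hasSum_one_digits h0 h1).summable (abs_digit_mul_pow_le h0 hd)

theorem hasSum_digitSum (h0 : 0 ≤ α) (h1 : α < 1) (hd : ∀ i, |d i| ≤ 1) :
    HasSum (fun i : ℕ => (d i : ℝ) * α ^ (i + 1)) (digitSum α d) :=
  (summable_digits h0 h1 hd).hasSum

theorem abs_digitSum_le (h0 : 0 ≤ α) (h1 : α < 1) (hd : ∀ i, |d i| ≤ 1) :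
    |digitSum α d| ≤ α / (1 - α) :=
  tsum_of_norm_bounded (f := fun i => (d i : ℝ) * α ^ (i + 1)) (hasSum_one_digits h0 h1)
    (abs_digit_mul_pow_le h0 hd)

theorem digitSum_sub (h0 : 0 ≤ α) (h1 : α < 1) (hd : ∀ i, |d i| ≤ 1) (he : ∀ i, |e i| ≤ 1) :
    digitSum α (fun i => d i - e i) = digitSum α d - digitSum α e := by
  have h := (hasSum_digitSum h0 h1 hd).sub (hasSum_digitSum h0 h1 he)
  rw [← h.tsum_eq]
  exact tsum_congr fun i => by push_cast; ring

theorem digitSum_neg : digitSum α (fun i => -d i) = -digitSum α d := by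
  simp [digitSum, tsum_neg]

theorem digitSum_eq_sum_add (h0 : 0 ≤ α) (h1 : α < 1) (hd : ∀ i, |d i| ≤ 1) (n : ℕ) :
    digitSum α d = ∑ i ∈ Finset.range n, (d i : ℝ) * α ^ (i + 1)
      + α ^ n * digitSum α (fun i => d (i + n)) := by
  rw [digitSum, ← (summable_digits h0 h1 hd).sum_add_tsum_nat_add n, digitSum, ← tsum_mul_left]
  congr 1
  exact tsum_congr fun i => by ring

theorem digitSum_succ (h0 : 0 ≤ α) (h1 : α < 1) (hd : ∀ i, |d i| ≤ 1) (n : ℕ) :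
    digitSum α (fun i => d (i + n)) = α * (d n + digitSum α (fun i => d (i + (n + 1)))) := by
  rw [digitSum_eq_sum_add h0 h1 (fun i => hd (i + n)) 1]
  simp [add_comm, add_left_comm, mul_add, mul_comm]

theorem digitSum_of_eq_zero (h0 : 0 ≤ α) (h1 : α < 1) (hd : ∀ i, |d i| ≤ 1) {n : ℕ}
    (h : ∀ i < n, d i = 0) : digitSum α d = α ^ n * digitSum α (fun i => d (i + n)) := by
  rw [digitSum_eq_sum_add h0 h1 hd n, Finset.sum_eq_zero, zero_add]
  intro i hi
  simp [h i (Finset.mem_range.1 hi)]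

theorem abs_digitSum_le_of_eq_zero (h0 : 0 ≤ α) (h1 : α < 1) (hd : ∀ i, |d i| ≤ 1) {n : ℕ}
    (h : ∀ i < n, d i = 0) : |digitSum α d| ≤ α ^ n * (α / (1 - α)) := by
  rw [digitSum_of_eq_zero h0 h1 hd h, abs_mul, abs_of_nonneg (pow_nonneg h0 n)]
  exact mul_le_mul_of_nonneg_left (abs_digitSum_le h0 h1 fun i => hd (i + n)) (by positivity)

theorem le_abs_digitSum (h0 : 0 ≤ α) (h1 : α < 1) (hd : ∀ i, |d i| ≤ 1) {n : ℕ}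
    (h : ∀ i < n, d i = 0) (hn : d n ≠ 0) :
    α ^ (n + 1) * (1 - α / (1 - α)) ≤ |digitSum α d| := by
  rw [digitSum_of_eq_zero h0 h1 hd h, digitSum_succ h0 h1 hd, ← mul_assoc, ← pow_succ, abs_mul,
    abs_of_nonneg (pow_nonneg h0 (n + 1))]
  refine mul_le_mul_of_nonneg_left ?_ (by positivity)
  have h2 : (1 : ℝ) ≤ |(d n : ℝ)| := by exact_mod_cast Int.one_le_abs hn
  have h3 := abs_digitSum_le h0 h1 fun i => hd (i + (n + 1))
  have h4 := abs_sub_abs_le_abs_sub (d n : ℝ) (-digitSum α (fun i => d (i + (n + 1))))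
  rw [abs_neg, sub_neg_eq_add] at h4
  linarith

/-- Greedy algorithm: if every point `x` of a bounded set `I` has a digit `a ∈ A` such that
`x / α - a` is again in `I`, then every point of `I` has an expansion over `A`. -/
theorem exists_isExpansion_of_greedy {A : Set ℤ} {I : Set ℝ} (h0 : 0 < α) (h1 : α < 1)
    (hA : ∀ a ∈ A, |a| ≤ 1) {B : ℝ} (hI : ∀ x ∈ I, |x| ≤ B)
    (h : ∀ x ∈ I, ∃ a ∈ A, x / α - a ∈ I) {x : ℝ} (hx : x ∈ I) :
    ∃ d, IsExpansion A α d x := by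
  choose! a haA haI using h
  let X : ℕ → ℝ := fun n => (fun y => y / α - a y)^[n] x
  have hX : ∀ n, X (n + 1) = X n / α - a (X n) := fun n => Function.iterate_succ_apply' _ n x
  have hXI : ∀ n, X n ∈ I := fun n => by
    induction n with
    | zero => exact hx
    | succ n ih => rw [hX]; exact haI _ ih
  have hsum : ∀ n, x = ∑ i ∈ Finset.range n, (a (X i) : ℝ) * α ^ (i + 1) + α ^ n * X n := by
    intro n
    induction n with
    | zero => simp [X]
    | succ n ih =>
      rw [Finset.sum_range_succ, hX]
      nth_rewrite 1 [ih]
      field_simp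
      ring
  have hd : ∀ i, |a (X i)| ≤ 1 := fun i => hA _ (haA _ (hXI i))
  refine ⟨fun i => a (X i), fun i => haA _ (hXI i), ?_⟩
  have hs := hasSum_digitSum h0.le h1 hd
  have ht : Filter.Tendsto (fun n : ℕ => α ^ n * X n) Filter.atTop (nhds 0) := by
    have hB : Filter.Tendsto (fun n : ℕ => α ^ n * B) Filter.atTop (nhds 0) := by
      simpa using (tendsto_pow_atTop_nhds_zero_of_lt_one h0.le h1).mul_const B
    refine squeeze_zero_norm (fun n => ?_) hB
    rw [Real.norm_eq_abs, abs_mul, abs_of_nonneg (pow_nonneg h0.le n)]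
    exact mul_le_mul_of_nonneg_left (hI _ (hXI n)) (by positivity)
  have h2 := hs.tendsto_sum_nat.add ht
  simp only [add_zero] at h2
  have h3 : (fun n => ∑ i ∈ Finset.range n, (a (X i) : ℝ) * α ^ (i + 1) + α ^ n * X n)
      = fun _ => x := funext fun n => (hsum n).symm
  rw [h3] at h2
  rwa [tendsto_nhds_unique tendsto_const_nhds h2]

theorem mem_signs_iff {a : ℤ} : a ∈ ({-1, 0, 1} : Set ℤ) ↔ |a| ≤ 1 := by
  simp only [Set.mem_insert_iff, Set.mem_singleton_iff, abs_le]
  omega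

theorem abs_le_one_of_mem_bits {a : ℤ} (h : a ∈ ({0, 1} : Set ℤ)) : |a| ≤ 1 := by
  rcases h with rfl | rfl <;> simp

theorem isExpansion_signs_iff (h0 : 0 ≤ α) (h1 : α < 1) {t : ℝ} :
    IsExpansion {-1, 0, 1} α d t ↔ (∀ i, |d i| ≤ 1) ∧ digitSum α d = t := by
  constructor
  · rintro ⟨h, hs⟩
    exact ⟨fun i => mem_signs_iff.1 (h i), hs.tsum_eq⟩
  · rintro ⟨h, rfl⟩
    exact ⟨fun i => mem_signs_iff.2 (h i), hasSum_digitSum h0 h1 h⟩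

theorem exists_signs_expansion (h0 : 1 / 3 ≤ α) (h1 : α < 1) {x : ℝ} (hx : |x| ≤ α / (1 - α)) :
    ∃ d : ℕ → ℤ, (∀ i, |d i| ≤ 1) ∧ digitSum α d = x := by
  have hα : 0 < α := by linarith
  have h2 : 0 < 1 - α := by linarith
  have hM : 1 / 2 ≤ α / (1 - α) := by rw [le_div_iff₀ h2]; linarith
  have hM' : α / (1 - α) = α * (1 + α / (1 - α)) := by field_simp; ring
  -- M ≥ 1/2, which is where α ≥ 1/3 enters, makes [-M, M] invariant when y/α is reduced by its
  -- nearest digit.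
  have hg : ∀ y ∈ Set.Icc (-(α / (1 - α))) (α / (1 - α)), ∃ a ∈ ({-1, 0, 1} : Set ℤ),
      y / α - a ∈ Set.Icc (-(α / (1 - α))) (α / (1 - α)) := by
    intro y hy
    have hy' : |y / α| ≤ 1 + α / (1 - α) := by
      rw [abs_div, abs_of_pos hα, div_le_iff₀ hα, mul_comm, ← hM']
      exact abs_le.2 hy
    obtain ⟨h3, h4⟩ := abs_le.1 hy'
    rcases lt_or_ge (1 / 2) (y / α) with h | h
    · refine ⟨1, by simp, ?_, ?_⟩ <;> push_cast <;> linarith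
    rcases lt_or_ge (y / α) (-(1 / 2)) with h' | h'
    · refine ⟨-1, by simp, ?_, ?_⟩ <;> push_cast <;> linarith
    · refine ⟨0, by simp, ?_, ?_⟩ <;> push_cast <;> linarith
  obtain ⟨d, hd⟩ := exists_isExpansion_of_greedy hα h1 (fun a => mem_signs_iff.1)
    (fun y hy => abs_le.2 hy) hg (abs_le.1 hx)
  exact ⟨d, (isExpansion_signs_iff hα.le h1).1 hd⟩

theorem exists_binary_expansion {x : ℝ} (hx : x ∈ Set.Icc (0 : ℝ) 1) :
    ∃ d : ℕ → ℤ, (∀ i, d i ∈ ({0, 1} : Set ℤ)) ∧ digitSum (1 / 2) d = x := by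
  have hg : ∀ y ∈ Set.Icc (0 : ℝ) 1, ∃ a ∈ ({0, 1} : Set ℤ),
      y / (1 / 2) - a ∈ Set.Icc (0 : ℝ) 1 := by
    rintro y ⟨h3, h4⟩
    rcases lt_or_ge (1 / 2) y with h | h
    · refine ⟨1, by simp, ?_, ?_⟩ <;> push_cast <;> linarith
    · refine ⟨0, by simp, ?_, ?_⟩ <;> push_cast <;> linarith
  obtain ⟨d, hd, hs⟩ := exists_isExpansion_of_greedy (by norm_num) (by norm_num)
    (fun a => abs_le_one_of_mem_bits) (fun y hy => abs_le.2 ⟨by linarith [hy.1], hy.2⟩) hg hx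
  exact ⟨d, hd, hs.tsum_eq⟩

end DigitSums

/-! ### Unique expansions and their tails -/

section Univoque

variable {α : ℝ} {d : ℕ → ℤ}

/-- `d` is the only `{-1, 0, 1}`-digit sequence with its value. -/
def IsUniqueDigits (α : ℝ) (d : ℕ → ℤ) : Prop :=
  (∀ i, |d i| ≤ 1) ∧ ∀ e : ℕ → ℤ, (∀ i, |e i| ≤ 1) → digitSum α e = digitSum α d → e = d

theorem IsUniqueDigits.neg (h : IsUniqueDigits α d) : IsUniqueDigits α (fun i => -d i) := by
  refine ⟨fun i => by simpa using h.1 i, fun e he hs => ?_⟩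
  have h2 := h.2 (fun i => -e i) (fun i => by simpa using he i)
    (by rw [digitSum_neg, hs, digitSum_neg, neg_neg])
  rw [← h2]
  simp

/-- Otherwise the tail minus 1 lies in [-M, M] and can be expanded again, so the digit at n could be
raised by 1 without changing the sum. -/
theorem IsUniqueDigits.digitSum_lt (h : IsUniqueDigits α d) (h0 : 1 / 3 ≤ α) (h1 : α < 1) {n : ℕ}
    (hn : d n ≤ 0) : digitSum α (fun i => d (i + (n + 1))) < 1 - α / (1 - α) := by
  have hα : 0 < α := by linarith
  by_contra! hge
  have hle := (abs_le.1 (abs_digitSum_le hα.le h1 fun i => h.1 (i + (n + 1)))).2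
  obtain ⟨e, he, hes⟩ := exists_signs_expansion h0 h1
    (x := digitSum α (fun i => d (i + (n + 1))) - 1) (abs_le.2 ⟨by linarith, by linarith⟩)
  let f : ℕ → ℤ := fun i => if i < n then d i else if i = n then d n + 1 else e (i - (n + 1))
  have hf : ∀ i, |f i| ≤ 1 := by
    intro i
    have hdn := abs_le.1 (h.1 n)
    simp only [f]
    split_ifs
    · exact h.1 i
    · exact abs_le.2 ⟨by linarith, by linarith⟩
    · exact he _
  have hfn : f n = d n + 1 := by simp [f]
  have hft : (fun i => f (i + (n + 1))) = e := by
    funext i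
    have h2 : ¬ i + (n + 1) < n := by omega
    have h3 : ¬ i + (n + 1) = n := by omega
    simp [f, h2, h3]
  have hfs : digitSum α f = digitSum α d := by
    rw [digitSum_eq_sum_add hα.le h1 hf n, digitSum_eq_sum_add hα.le h1 h.1 n,
      digitSum_succ hα.le h1 hf, digitSum_succ hα.le h1 h.1, hft, hes, hfn]
    congr 1
    · refine Finset.sum_congr rfl fun i hi => ?_
      simp [f, Finset.mem_range.1 hi]
    · push_cast
      ring
  have h2 := congrFun (h.2 f hf hfs) n
  omega

/-- At the first place where two expansions differ, the digits differ by at least 1, but the tails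
differ by less than (1 - M) + M. -/
theorem isUniqueDigits_of_abs_digitSum_lt (h0 : 0 < α) (h1 : α < 1) (hd : ∀ i, |d i| ≤ 1)
    (h : ∀ n, |digitSum α (fun i => d (i + (n + 1)))| < 1 - α / (1 - α)) :
    IsUniqueDigits α d := by
  refine ⟨hd, fun e he hs => ?_⟩
  by_contra hne
  have hex : ∃ n, e n ≠ d n := by
    by_contra! hc
    exact hne (funext hc)
  classical
  let n := Nat.find hex
  have hn : e n ≠ d n := Nat.find_spec hex
  have hlt : ∀ i < n, e i = d i := fun i hi => not_not.1 (Nat.find_min hex hi)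
  rw [digitSum_eq_sum_add h0.le h1 he n, digitSum_eq_sum_add h0.le h1 hd n,
    Finset.sum_congr rfl fun i hi => by rw [hlt i (Finset.mem_range.1 hi)], add_right_inj,
    mul_right_inj' (pow_pos h0 n).ne', digitSum_succ h0.le h1 he, digitSum_succ h0.le h1 hd,
    mul_right_inj' h0.ne'] at hs
  have h2 : (1 : ℝ) ≤ |(e n : ℝ) - d n| := by
    exact_mod_cast Int.one_le_abs (sub_ne_zero.2 hn)
  have h3 := abs_digitSum_le h0.le h1 fun i => he (i + (n + 1))
  have h4 := h n
  have h5 : (e n : ℝ) - d n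
      = digitSum α (fun i => d (i + (n + 1))) - digitSum α (fun i => e (i + (n + 1))) := by
    linarith
  have h6 := abs_sub (digitSum α (fun i => d (i + (n + 1)))) (digitSum α (fun i => e (i + (n + 1))))
  rw [h5] at h2
  linarith

/-- Positive and negative parts of d are binary, so membership in Γ - Γ is automatic. -/
theorem mem_cantorGamma_sub (h0 : 0 ≤ α) (h1 : α < 1) (hd : ∀ i, |d i| ≤ 1) :
    digitSum α d ∈ cantorGamma α - cantorGamma α := by
  let u : ℕ → ℤ := fun i => if d i = 1 then 1 else 0
  let v : ℕ → ℤ := fun i => if d i = -1 then 1 else 0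
  have hu : ∀ i, u i ∈ ({0, 1} : Set ℤ) := fun i => by
    by_cases h : d i = 1 <;> simp [u, h]
  have hv : ∀ i, v i ∈ ({0, 1} : Set ℤ) := fun i => by
    by_cases h : d i = -1 <;> simp [v, h]
  have hu' := fun i => abs_le_one_of_mem_bits (hu i)
  have hv' := fun i => abs_le_one_of_mem_bits (hv i)
  refine Set.mem_sub.2 ⟨digitSum α u, ⟨u, hu, hasSum_digitSum h0 h1 hu'⟩, digitSum α v,
    ⟨v, hv, hasSum_digitSum h0 h1 hv'⟩, ?_⟩
  rw [← digitSum_sub h0 h1 hu' hv']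
  congr 1
  funext i
  obtain h | h | h : d i = -1 ∨ d i = 0 ∨ d i = 1 := mem_signs_iff.2 (hd i)
  all_goals simp [u, v, h]

theorem mem_univoqueSet_iff (h0 : 0 ≤ α) (h1 : α < 1) {t : ℝ} :
    t ∈ univoqueSet α ↔ ∃ d, IsUniqueDigits α d ∧ digitSum α d = t := by
  simp only [univoqueSet, Set.mem_ofPred_eq, ExistsUnique, isExpansion_signs_iff h0 h1]
  constructor
  · rintro ⟨-, d, ⟨hd, hs⟩, hu⟩
    exact ⟨d, ⟨hd, fun e he hes => hu e ⟨he, hes.trans hs⟩⟩, hs⟩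
  · rintro ⟨d, hd, rfl⟩
    exact ⟨mem_cantorGamma_sub h0 h1 hd.1, d, ⟨hd.1, rfl⟩, fun e he => hd.2 e he.1 he.2⟩

theorem mem_univoqueSeq_iff (h0 : 0 ≤ α) (h1 : α < 1) :
    d ∈ univoqueSeq α ↔ IsUniqueDigits α d := by
  simp only [univoqueSeq, Set.mem_ofPred_eq, mem_univoqueSet_iff h0 h1, isExpansion_signs_iff h0 h1]
  constructor
  · rintro ⟨t, ⟨e, he, rfl⟩, hd, hs⟩
    rwa [he.2 d hd hs]
  · exact fun h => ⟨_, ⟨d, h, rfl⟩, h.1, rfl⟩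

end Univoque

/-! ### Bounds on the zero-frequency -/

section LowerZeroFreq

/-- The frequency of the digit `0` among the first `n` digits. -/
noncomputable def zeroFreq (d : ℕ → ℤ) (n : ℕ) : ℝ :=
  (((Finset.range n).filter (fun i => d i = 0)).card : ℝ) / (n : ℝ)

theorem lowerZeroFreq_eq (d : ℕ → ℤ) :
    lowerZeroFreq d = Filter.liminf (zeroFreq d) Filter.atTop := rfl

theorem zeroFreq_nonneg (d : ℕ → ℤ) (n : ℕ) : 0 ≤ zeroFreq d n := by
  unfold zeroFreq; positivity

theorem zeroFreq_le_one (d : ℕ → ℤ) (n : ℕ) : zeroFreq d n ≤ 1 := by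
  refine div_le_one_of_le₀ ?_ (by positivity)
  exact_mod_cast (Finset.card_filter_le _ _).trans (Finset.card_range n).le

theorem isBoundedUnder_ge_zeroFreq (d : ℕ → ℤ) :
    Filter.atTop.IsBoundedUnder (· ≥ ·) (zeroFreq d) :=
  Filter.isBoundedUnder_of ⟨0, zeroFreq_nonneg d⟩

theorem isCoboundedUnder_ge_zeroFreq (d : ℕ → ℤ) :
    Filter.atTop.IsCoboundedUnder (· ≥ ·) (zeroFreq d) :=
  (Filter.isBoundedUnder_of ⟨1, zeroFreq_le_one d⟩).isCoboundedUnder_ge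

theorem lowerZeroFreq_nonneg (d : ℕ → ℤ) : 0 ≤ lowerZeroFreq d :=
  Filter.le_liminf_of_le (isCoboundedUnder_ge_zeroFreq d) (.of_forall (zeroFreq_nonneg d))

theorem lowerZeroFreq_le_one (d : ℕ → ℤ) : lowerZeroFreq d ≤ 1 :=
  Filter.liminf_le_of_frequently_le (Filter.Frequently.of_forall (zeroFreq_le_one d))
    (isBoundedUnder_ge_zeroFreq d)

end LowerZeroFreq

/-! ### Dimension of the overlap set -/

section Overlap

variable {α s : ℝ} {d e e' : ℕ → ℤ}

/-- The binary digit sequences `e` such that `e - d` is again a binary digit sequence. -/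
def overlapDigits (d : ℕ → ℤ) : Set (ℕ → ℤ) :=
  {e | ∀ i, e i ∈ ({0, 1} : Set ℤ) ∧ e i - d i ∈ ({0, 1} : Set ℤ)}

theorem eq_of_mem_overlapDigits (he : e ∈ overlapDigits d) (he' : e' ∈ overlapDigits d) {i : ℕ}
    (hi : d i ≠ 0) : e i = e' i := by
  have h := he i
  have h' := he' i
  simp only [Set.mem_insert_iff, Set.mem_singleton_iff] at h h'
  omega

theorem abs_le_one_of_mem_overlapDigits (he : e ∈ overlapDigits d) (i : ℕ) : |e i| ≤ 1 :=
  abs_le_one_of_mem_bits (he i).1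

theorem abs_sub_le_one_of_mem_bits {a b : ℤ} (ha : a ∈ ({0, 1} : Set ℤ))
    (hb : b ∈ ({0, 1} : Set ℤ)) : |a - b| ≤ 1 := by
  simp only [Set.mem_insert_iff, Set.mem_singleton_iff] at ha hb
  rw [abs_le]
  omega

theorem abs_sub_le_one_of_mem_overlapDigits (he : e ∈ overlapDigits d)
    (he' : e' ∈ overlapDigits d) (i : ℕ) : |e i - e' i| ≤ 1 :=
  abs_sub_le_one_of_mem_bits (he i).1 (he' i).1

/-- A common point has binary expansions e of x and f of x - t; then e - f expands t, so uniqueness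
forces e - f = d. -/
theorem cantorGamma_inter_translate (h0 : 0 ≤ α) (h1 : α < 1) (hd : IsUniqueDigits α d) :
    cantorGamma α ∩ (fun x => x + digitSum α d) '' cantorGamma α
      = digitSum α '' overlapDigits d := by
  ext x
  constructor
  · rintro ⟨⟨e, he, hes⟩, y, ⟨f, hf, hfs⟩, hxy⟩
    have he' := fun i => abs_le_one_of_mem_bits (he i)
    have hf' := fun i => abs_le_one_of_mem_bits (hf i)
    have hx : digitSum α e = x := hes.tsum_eq
    have hy : digitSum α f = y := hfs.tsum_eq
    have h2 : (fun i => e i - f i) = d := by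
      refine hd.2 _ (fun i => abs_sub_le_one_of_mem_bits (he i) (hf i)) ?_
      rw [digitSum_sub h0 h1 he' hf', hx, hy]
      simp only at hxy
      linarith
    refine ⟨e, fun i => ⟨he i, ?_⟩, hx⟩
    rw [← h2]
    simpa using hf i
  · rintro ⟨e, he, rfl⟩
    have h2 := fun i => abs_le_one_of_mem_bits (he i).2
    refine ⟨⟨e, fun i => (he i).1, hasSum_digitSum h0 h1 (abs_le_one_of_mem_overlapDigits he)⟩,
      digitSum α fun i => e i - d i, ⟨_, fun i => (he i).2, hasSum_digitSum h0 h1 h2⟩, ?_⟩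
    simp only
    rw [digitSum_sub h0 h1 (abs_le_one_of_mem_overlapDigits he) hd.1]
    ring

theorem exists_first_difference (h0 : 0 ≤ α) (h1 : α < 1) (he : e ∈ overlapDigits d)
    (he' : e' ∈ overlapDigits d) (hne : e ≠ e') :
    ∃ n, (∀ i < n, e i = e' i) ∧
      α ^ (n + 1) * (1 - α / (1 - α)) ≤ |digitSum α e - digitSum α e'| := by
  classical
  have hex : ∃ n, e n ≠ e' n := by
    by_contra! hc
    exact hne (funext hc)
  refine ⟨Nat.find hex, fun i hi => not_not.1 (Nat.find_min hex hi), ?_⟩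
  rw [← digitSum_sub h0 h1 (abs_le_one_of_mem_overlapDigits he)
    (abs_le_one_of_mem_overlapDigits he')]
  exact le_abs_digitSum h0 h1 (abs_sub_le_one_of_mem_overlapDigits he he')
    (fun i hi => sub_eq_zero.2 (not_not.1 (Nat.find_min hex hi)))
    (sub_ne_zero.2 (Nat.find_spec hex))

theorem tail_ratio_lt_one (h2 : α < 1 / 2) : α / (1 - α) < 1 := by
  rw [div_lt_one (by linarith)]
  linarith

theorem digitSum_injOn_overlapDigits (h0 : 0 < α) (h2 : α < 1 / 2) :
    Set.InjOn (digitSum α) (overlapDigits d) := by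
  intro e he e' he' h
  by_contra hne
  obtain ⟨n, -, hn⟩ := exists_first_difference h0.le (by linarith) he he' hne
  have h3 : 0 < α ^ (n + 1) * (1 - α / (1 - α)) :=
    mul_pos (by positivity) (sub_pos.2 (tail_ratio_lt_one h2))
  rw [h, sub_self, abs_zero] at hn
  linarith

/-- Turns comparisons of 2^k (α^n)^s with 1 into linear ones between k log 2 and n s (-log α). -/
theorem two_pow_mul_rpow_eq_exp (h0 : 0 < α) (k n : ℕ) (s : ℝ) :
    (2 : ℝ) ^ k * (α ^ n) ^ s = Real.exp (k * Real.log 2 - n * (s * -Real.log α)) := by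
  rw [← Real.rpow_natCast 2 k, Real.rpow_def_of_pos two_pos, Real.rpow_def_of_pos (pow_pos h0 n),
    ← Real.exp_add, Real.log_pow]
  congr 1
  ring

theorem dimH_image_overlapDigits_le (h0 : 0 < α) (h1 : α < 1) (hs : 0 < s)
    (h : lowerZeroFreq d * (Real.log 2 / -Real.log α) < s) :
    dimH (digitSum α '' overlapDigits d) ≤ ENNReal.ofReal s := by
  have hlog2 : 0 < Real.log 2 := Real.log_pos one_lt_two
  have hlogα : 0 < -Real.log α := neg_pos.2 (Real.log_neg h0 h1)
  have hM : 0 < α / (1 - α) := div_pos h0 (by linarith)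
  -- Infinitely many good scales suffice, because the Hausdorff measure is bounded by a liminf over
  -- covers.
  have hfreq : ∃ᶠ n in Filter.atTop, zeroFreq d n < s * -Real.log α / Real.log 2 := by
    refine Filter.frequently_lt_of_liminf_lt (isCoboundedUnder_ge_zeroFreq d) ?_
    rw [← lowerZeroFreq_eq, lt_div_iff₀ hlog2]
    rwa [mul_div_assoc', div_lt_iff₀ hlogα] at h
  refine dimH_le_of_hausdorffMeasure_ne_top (d := s.toNNReal) ?_
  rw [Real.coe_toNNReal s hs.le]
  let Z : ℕ → Finset ℕ := fun n => (Finset.range n).filter (fun i => d i = 0)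
  -- One cylinder for each choice of the free digits below n.
  let t : ∀ n, (Z n).powerset → Set ℝ := fun n S =>
    digitSum α '' {e | e ∈ overlapDigits d ∧ ∀ i < n, d i = 0 → (e i = 1 ↔ i ∈ (S : Finset ℕ))}
  have hdiam : ∀ n S, Metric.ediam (t n S) ≤ ENNReal.ofReal (α ^ n * (α / (1 - α))) := by
    intro n S
    refine Metric.ediam_le ?_
    rintro - ⟨e, ⟨he, heS⟩, rfl⟩ - ⟨e', ⟨he', heS'⟩, rfl⟩
    rw [edist_dist, Real.dist_eq, ← digitSum_sub h0.le h1 (abs_le_one_of_mem_overlapDigits he)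
      (abs_le_one_of_mem_overlapDigits he')]
    refine ENNReal.ofReal_le_ofReal (abs_digitSum_le_of_eq_zero h0.le h1
      (abs_sub_le_one_of_mem_overlapDigits he he') fun i hi => sub_eq_zero.2 ?_)
    by_cases hi0 : d i = 0
    · have h3 := (heS i hi hi0).trans (heS' i hi hi0).symm
      have h4 := (he i).1
      have h5 := (he' i).1
      simp only [Set.mem_insert_iff, Set.mem_singleton_iff] at h4 h5
      omega
    · exact eq_of_mem_overlapDigits he he' hi0
  have hcover : ∀ n, digitSum α '' overlapDigits d ⊆ ⋃ S, t n S := by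
    rintro n - ⟨e, he, rfl⟩
    refine Set.mem_iUnion.2 ⟨⟨(Z n).filter (fun i => e i = 1),
      Finset.mem_powerset.2 (Finset.filter_subset _ _)⟩, e, ⟨he, fun i hi hi0 => ?_⟩, rfl⟩
    simp [Z, hi, hi0]
  have htend : Filter.Tendsto (fun n : ℕ => ENNReal.ofReal (α ^ n * (α / (1 - α)))) Filter.atTop
      (nhds 0) := by
    rw [← ENNReal.ofReal_zero]
    refine ENNReal.tendsto_ofReal ?_
    simpa using (tendsto_pow_atTop_nhds_zero_of_lt_one h0.le h1).mul_const (α / (1 - α))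
  have hmeas := MeasureTheory.Measure.hausdorffMeasure_le_liminf_sum s
    (digitSum α '' overlapDigits d) _ htend t (.of_forall hdiam) (.of_forall hcover)
  refine ne_top_of_le_ne_top (ENNReal.ofReal_ne_top (r := (α / (1 - α)) ^ s))
    (hmeas.trans (Filter.liminf_le_of_frequently_le' ?_))
  refine (hfreq.and_eventually (Filter.eventually_gt_atTop 0)).mono fun n hn => ?_
  obtain ⟨hn, hn0⟩ := hn
  have hn0' : (0 : ℝ) < n := by exact_mod_cast hn0
  have hZ : (2 : ℝ) ^ (Z n).card * (α ^ n) ^ s ≤ 1 := by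
    rw [two_pow_mul_rpow_eq_exp h0, Real.exp_le_one_iff, sub_nonpos]
    have h3 : ((Z n).card : ℝ) / n < s * -Real.log α / Real.log 2 := hn
    rw [div_lt_div_iff₀ hn0' hlog2] at h3
    linarith
  calc ∑ S, Metric.ediam (t n S) ^ s
      ≤ ∑ S : (Z n).powerset, ENNReal.ofReal (α ^ n * (α / (1 - α))) ^ s :=
        Finset.sum_le_sum fun S _ => ENNReal.rpow_le_rpow (hdiam n S) hs.le
    _ = ENNReal.ofReal (2 ^ (Z n).card * (α ^ n) ^ s * (α / (1 - α)) ^ s) := by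
        rw [Finset.sum_const, Finset.card_univ, Fintype.card_coe, Finset.card_powerset,
          ENNReal.ofReal_rpow_of_pos (by positivity), Real.mul_rpow (by positivity) hM.le,
          mul_assoc, ENNReal.ofReal_mul (p := 2 ^ (Z n).card) (by positivity), nsmul_eq_mul,
          ENNReal.ofReal_pow two_pos.le]
        simp
    _ ≤ ENNReal.ofReal ((α / (1 - α)) ^ s) :=
        ENNReal.ofReal_le_ofReal (mul_le_of_le_one_left (by positivity) hZ)

/-- This decay rate supplies the Hölder exponent in the lower bound; C absorbs the finitely many n
before the frequency estimate holds. -/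
theorem exists_half_pow_count_le (h0 : 0 < α) (h1 : α < 1) (hs : 0 < s)
    (h : s < lowerZeroFreq d * (Real.log 2 / -Real.log α)) :
    ∃ C : ℝ, 0 < C ∧ ∀ n, (1 / 2 : ℝ) ^ Nat.count (fun i => d i = 0) n ≤ C * (α ^ n) ^ s := by
  have hlog2 : 0 < Real.log 2 := Real.log_pos one_lt_two
  have hlogα : 0 < -Real.log α := neg_pos.2 (Real.log_neg h0 h1)
  have hev : ∀ᶠ n in Filter.atTop, s * -Real.log α / Real.log 2 < zeroFreq d n := by
    refine Filter.eventually_lt_of_lt_liminf ?_ (isBoundedUnder_ge_zeroFreq d)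
    rw [← lowerZeroFreq_eq, div_lt_iff₀ hlog2]
    rwa [mul_div_assoc', lt_div_iff₀ hlogα] at h
  obtain ⟨N, hN⟩ := Filter.eventually_atTop.1 hev
  have hpos : ∀ n : ℕ, 0 < (α ^ n) ^ s := fun n => Real.rpow_pos_of_pos (pow_pos h0 n) s
  refine ⟨1 / (α ^ (N + 1)) ^ s, one_div_pos.2 (hpos _), fun n => ?_⟩
  have hC : 1 ≤ 1 / (α ^ (N + 1)) ^ s :=
    (one_le_div (hpos _)).2 (Real.rpow_le_one (by positivity) (pow_le_one₀ h0.le h1.le) hs.le)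
  rcases le_or_gt (N + 1) n with hn | hn
  · have hn0' : (0 : ℝ) < n := by exact_mod_cast (by omega : 0 < n)
    have h3 := hN n (by omega)
    rw [zeroFreq, ← Nat.count_eq_card_filter_range, div_lt_div_iff₀ hlog2 hn0'] at h3
    have h4 : 1 ≤ (2 : ℝ) ^ Nat.count (fun i => d i = 0) n * (α ^ n) ^ s := by
      rw [two_pow_mul_rpow_eq_exp h0, Real.one_le_exp_iff]
      linarith
    refine le_trans ?_ (le_mul_of_one_le_left (hpos n).le hC)
    rwa [one_div_pow, div_le_iff₀ (by positivity), mul_comm]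
  · refine (pow_le_one₀ (by norm_num) (by norm_num)).trans ?_
    rw [one_div_mul_eq_div, one_le_div (hpos _)]
    exact Real.rpow_le_rpow (by positivity) (pow_le_pow_of_le_one h0.le h1.le hn.le) hs.le

theorem setOf_zero_infinite (h0 : 0 < α) (h1 : α < 1) (hs : 0 < s)
    (h : s < lowerZeroFreq d * (Real.log 2 / -Real.log α)) :
    {i | d i = 0}.Infinite := by
  intro hfin
  obtain ⟨C, hC, hle⟩ := exists_half_pow_count_le h0 h1 hs h
  have hcount : ∀ n, Nat.count (fun i => d i = 0) n ≤ hfin.toFinset.card := fun n => by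
    rw [Nat.count_eq_card_filter_range]
    exact Finset.card_le_card fun i hi => by simpa using (Finset.mem_filter.1 hi).2
  have ht : Filter.Tendsto (fun n : ℕ => C * (α ^ n) ^ s) Filter.atTop (nhds 0) := by
    have h2 := (tendsto_pow_atTop_nhds_zero_of_lt_one (Real.rpow_nonneg h0.le s)
      (Real.rpow_lt_one h0.le h1 hs)).const_mul C
    rw [mul_zero] at h2
    refine h2.congr fun n => ?_
    rw [← Real.rpow_natCast, ← Real.rpow_natCast, ← Real.rpow_mul h0.le, ← Real.rpow_mul h0.le,
      mul_comm s]
  have h3 : (1 / 2 : ℝ) ^ hfin.toFinset.card ≤ 0 :=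
    ge_of_tendsto' ht fun n => (pow_le_pow_of_le_one (by norm_num) (by norm_num)
      (hcount n)).trans (hle n)
  have h4 : (0 : ℝ) < (1 / 2) ^ hfin.toFinset.card := by positivity
  linarith

theorem le_dimH_image_overlapDigits (h0 : 0 < α) (h2 : α < 1 / 2) (hd : ∀ i, |d i| ≤ 1)
    (hs : 0 < s) (h : s < lowerZeroFreq d * (Real.log 2 / -Real.log α)) :
    ENNReal.ofReal s ≤ dimH (digitSum α '' overlapDigits d) := by
  have h1 : α < 1 := by linarith
  have hinf := setOf_zero_infinite h0 h1 hs h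
  obtain ⟨C, hC, hle⟩ := exists_half_pow_count_le h0 h1 hs h
  have hex : ∀ x ∈ digitSum α '' overlapDigits d, ∃ e ∈ overlapDigits d, digitSum α e = x :=
    fun x hx => hx
  choose! E hE hEx using hex
  let z : ℕ → ℕ := Nat.nth fun i => d i = 0
  -- The free digits of x, read in base 2.
  let f : ℝ → ℝ := fun x => digitSum (1 / 2) fun k => E x (z k)
  have himage : Set.Icc 0 1 ⊆ f '' (digitSum α '' overlapDigits d) := by
    intro y hy
    obtain ⟨b, hb, rfl⟩ := exists_binary_expansion hy
    -- Bits of y go to the zeros of d in order; the other digits are forced.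
    let e : ℕ → ℤ := fun i =>
      if d i = 0 then b (Nat.count (fun i => d i = 0) i) else if d i = 1 then 1 else 0
    have he : e ∈ overlapDigits d := by
      intro i
      obtain hi | hi | hi : d i = -1 ∨ d i = 0 ∨ d i = 1 := mem_signs_iff.2 (hd i)
      · simp [e, hi]
      · simpa [e, hi] using hb _
      · simp [e, hi]
    have hmem := Set.mem_image_of_mem (digitSum α) he
    refine ⟨_, hmem, ?_⟩
    have hEe : E (digitSum α e) = e :=
      digitSum_injOn_overlapDigits h0 h2 (hE _ hmem) he (hEx _ hmem)
    simp only [f, hEe]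
    congr 1
    funext k
    have hz : d (z k) = 0 := Nat.nth_mem_of_infinite hinf k
    have hzc : Nat.count (fun i => d i = 0) (z k) = k := Nat.count_nth_of_infinite hinf k
    simp [e, hz, hzc]
  have hc : 0 < α * (1 - α / (1 - α)) := mul_pos h0 (sub_pos.2 (tail_ratio_lt_one h2))
  have hholder : HolderOnWith (C * (1 / (α * (1 - α / (1 - α)))) ^ s).toNNReal s.toNNReal f
      (digitSum α '' overlapDigits d) := by
    intro x hx y hy
    rw [Real.coe_toNNReal s hs.le, edist_dist, edist_dist,
      ENNReal.ofReal_rpow_of_nonneg dist_nonneg hs.le]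
    change _ ≤ ENNReal.ofReal _ * _
    rw [← ENNReal.ofReal_mul (by positivity)]
    refine ENNReal.ofReal_le_ofReal ?_
    by_cases hxy : E x = E y
    · have hf : f x = f y := by simp only [f, hxy]
      rw [hf, dist_self]
      positivity
    obtain ⟨n, hn, hdist⟩ := exists_first_difference h0.le h1 (hE x hx) (hE y hy) hxy
    rw [hEx x hx, hEx y hy, ← Real.dist_eq] at hdist
    have hf : dist (f x) (f y) ≤ (1 / 2) ^ Nat.count (fun i => d i = 0) n := by
      rw [Real.dist_eq]
      simp only [f]
      rw [← digitSum_sub (by norm_num) (by norm_num)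
        (fun k => abs_le_one_of_mem_overlapDigits (hE x hx) (z k))
        (fun k => abs_le_one_of_mem_overlapDigits (hE y hy) (z k))]
      -- Agreement below n fixes as many bits as d has zeros below n; in base 2 the tail constant is
      -- 1.
      refine (abs_digitSum_le_of_eq_zero (by norm_num) (by norm_num)
        (fun k => abs_sub_le_one_of_mem_overlapDigits (hE x hx) (hE y hy) (z k))
        (fun k hk => sub_eq_zero.2 (hn _ (Nat.nth_lt_of_lt_count hk)))).trans ?_
      norm_num
    refine hf.trans ((hle n).trans ?_)
    rw [mul_assoc, ← Real.mul_rpow (by positivity) dist_nonneg, one_div_mul_eq_div]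
    refine mul_le_mul_of_nonneg_left (Real.rpow_le_rpow (by positivity) ?_ hs.le) hC.le
    rw [le_div_iff₀ hc, ← mul_assoc, ← pow_succ]
    exact hdist
  have hspos : 0 < s.toNNReal := Real.toNNReal_pos.2 hs
  have hdim := (dimH_mono himage).trans (hholder.dimH_image_le hspos)
  rw [Real.dimH_of_nonempty_interior (by simp [interior_Icc]), Module.finrank_self, Nat.cast_one,
    ENNReal.le_div_iff_mul_le (by simp [hs]) (by simp), one_mul] at hdim
  exact hdim

theorem dimH_image_overlapDigits (h0 : 0 < α) (h2 : α < 1 / 2) (hd : ∀ i, |d i| ≤ 1) :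
    dimH (digitSum α '' overlapDigits d)
      = ENNReal.ofReal (lowerZeroFreq d * (Real.log 2 / -Real.log α)) := by
  have h1 : α < 1 := by linarith
  have hnonneg : 0 ≤ lowerZeroFreq d * (Real.log 2 / -Real.log α) :=
    mul_nonneg (lowerZeroFreq_nonneg d)
      (div_nonneg (Real.log_nonneg one_le_two) (neg_nonneg.2 (Real.log_nonpos h0.le h1.le)))
  refine le_antisymm (le_of_forall_gt fun b hb => ?_) (le_of_forall_lt fun b hb => ?_)
  · obtain ⟨r, hr, hrb⟩ := ENNReal.lt_iff_exists_nnreal_btwn.1 hb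
    have hr' := (ENNReal.ofReal_lt_coe_iff hnonneg).1 hr
    refine (dimH_image_overlapDigits_le h0 h1 (hnonneg.trans_lt hr') hr').trans_lt ?_
    rwa [ENNReal.ofReal_coe_nnreal]
  · obtain ⟨r, hbr, hr⟩ := ENNReal.lt_iff_exists_nnreal_btwn.1 hb
    have hr' : (r : ℝ) < _ := (ENNReal.lt_ofReal_iff_toReal_lt ENNReal.coe_ne_top).1 hr
    have hr0 : (0 : ℝ) < r := NNReal.coe_pos.2 (ENNReal.coe_pos.1 (bot_le.trans_lt hbr))
    have h3 := le_dimH_image_overlapDigits h0 h2 hd hr0 hr'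
    rw [ENNReal.ofReal_coe_nnreal] at h3
    exact hbr.trans_le h3

end Overlap

/-! ### Dimensions in terms of zero-frequency -/

section DimensionFormula

variable {α : ℝ}

theorem dim_bound_pos (h0 : 0 < α) (h1 : α < 1) : 0 < Real.log 2 / -Real.log α :=
  div_pos (Real.log_pos one_lt_two) (neg_pos.2 (Real.log_neg h0 h1))

theorem mem_dimSet_iff (h0 : 0 < α) (h2 : α < 1 / 2) {x : ENNReal} :
    x ∈ dimSet α ↔ ∃ d, IsUniqueDigits α d ∧
      x = ENNReal.ofReal (lowerZeroFreq d * (Real.log 2 / -Real.log α)) := by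
  have h1 : α < 1 := by linarith
  simp only [dimSet, Set.mem_ofPred_eq, mem_univoqueSet_iff h0.le h1]
  constructor
  · rintro ⟨-, ⟨d, hd, rfl⟩, rfl⟩
    exact ⟨d, hd, by
      rw [cantorGamma_inter_translate h0.le h1 hd, dimH_image_overlapDigits h0 h2 hd.1]⟩
  · rintro ⟨d, hd, rfl⟩
    exact ⟨_, ⟨d, hd, rfl⟩, by
      rw [cantorGamma_inter_translate h0.le h1 hd, dimH_image_overlapDigits h0 h2 hd.1]⟩

theorem dimSet_subset (h0 : 0 < α) (h2 : α < 1 / 2) :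
    dimSet α ⊆ Set.Icc 0 (ENNReal.ofReal (Real.log 2 / -Real.log α)) := by
  intro x hx
  obtain ⟨d, -, rfl⟩ := (mem_dimSet_iff h0 h2).1 hx
  exact ⟨bot_le, ENNReal.ofReal_le_ofReal (mul_le_of_le_one_left
    (dim_bound_pos h0 (by linarith)).le (lowerZeroFreq_le_one d))⟩

end DimensionFormula

/-! ### Small α: alternating digits of every frequency -/

section AlternatingDigits

variable {α : ℝ} {e : ℕ → ℤ}

theorem digitSum_pos_of_bits (h0 : 0 < α) (h1 : α < 1) (he : ∀ i, e i ∈ ({0, 1} : Set ℤ)) {j : ℕ}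
    (hj : e j = 1) : 0 < digitSum α e := by
  have hnonneg : ∀ i, 0 ≤ (e i : ℝ) * α ^ (i + 1) := fun i => by
    have h2 : 0 ≤ e i := by
      obtain h | h : e i = 0 ∨ e i = 1 := he i <;> simp [h]
    have h3 : (0 : ℝ) ≤ e i := by exact_mod_cast h2
    positivity
  refine lt_of_lt_of_le ?_ ((summable_digits h0.le h1 fun i =>
    abs_le_one_of_mem_bits (he i)).le_tsum j fun i _ => hnonneg i)
  rw [hj]
  positivity

theorem digitSum_lt_of_bits (h0 : 0 < α) (h1 : α < 1) (he : ∀ i, e i ∈ ({0, 1} : Set ℤ)) {j : ℕ}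
    (hj : e j = 0) : digitSum α e < α / (1 - α) := by
  have h2 : digitSum α (fun _ => 1) = α / (1 - α) := by
    simpa [digitSum] using (hasSum_one_digits h0.le h1).tsum_eq
  have h3 := digitSum_pos_of_bits (e := fun i => 1 - e i) h0 h1
    (fun i => by obtain h | h : e i = 0 ∨ e i = 1 := he i <;> simp [h]) (j := j) (by simp [hj])
  rw [digitSum_sub (d := fun _ => 1) h0.le h1 (by simp) fun i => abs_le_one_of_mem_bits (he i),
    h2] at h3
  linarith

/-- With S the sum of e from place m + 1 on, the difference equals (1-α)S - α e_m, and 0 < (1-α)S <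
α strictly because both bits recur. -/
theorem abs_digitSum_sub_shift_lt (h0 : 0 < α) (h1 : α < 1) (he : ∀ i, e i ∈ ({0, 1} : Set ℤ))
    (hz : ∀ m, ∃ j ≥ m, e j = 0) (ho : ∀ m, ∃ j ≥ m, e j = 1) (m : ℕ) :
    |digitSum α (fun i => e (i + m + 1) - e (i + m))| < α := by
  have he' := fun i => abs_le_one_of_mem_bits (he i)
  obtain ⟨j, hj, hj0⟩ := hz (m + 1)
  obtain ⟨k, hk, hk1⟩ := ho (m + 1)
  have h3 := digitSum_lt_of_bits (e := fun i => e (i + (m + 1))) h0 h1 (fun i => he _)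
    (j := j - (m + 1)) (by simpa [Nat.sub_add_cancel hj] using hj0)
  have h4 := digitSum_pos_of_bits (e := fun i => e (i + (m + 1))) h0 h1 (fun i => he _)
    (j := k - (m + 1)) (by simpa [Nat.sub_add_cancel hk] using hk1)
  have h5 : 0 < 1 - α := by linarith
  rw [digitSum_sub h0.le h1 (fun i => he' (i + m + 1)) fun i => he' (i + m),
    digitSum_succ h0.le h1 he' m]
  simp only [← add_assoc] at h3 h4 ⊢
  rw [lt_div_iff₀ h5] at h3
  have h6 := mul_pos h4 h5
  obtain h | h : e m = 0 ∨ e m = 1 := he m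
  · rw [h, abs_lt]
    push_cast
    constructor <;> linarith
  · rw [h, abs_lt]
    push_cast
    constructor <;> linarith

/-- The parity of `⌊μ n⌋`. -/
noncomputable def floorParity (μ : ℝ) (n : ℕ) : ℤ := (⌊μ * n⌋₊ % 2 : ℕ)

/-- The digit sequence whose nonzero digits alternate in sign and occur with frequency `μ`. -/
noncomputable def alternatingDigits (μ : ℝ) (n : ℕ) : ℤ := floorParity μ (n + 1) - floorParity μ n

theorem floorParity_mem (μ : ℝ) (n : ℕ) : floorParity μ n ∈ ({0, 1} : Set ℤ) := by
  unfold floorParity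
  simp only [Set.mem_insert_iff, Set.mem_singleton_iff]
  omega

theorem abs_alternatingDigits_le (μ : ℝ) (n : ℕ) : |alternatingDigits μ n| ≤ 1 :=
  abs_sub_le_one_of_mem_bits (floorParity_mem μ _) (floorParity_mem μ _)

variable {μ : ℝ}

theorem exists_floor_mul_eq (h0 : 0 < μ) (h1 : μ ≤ 1) (N : ℕ) : ∃ n ≥ N, ⌊μ * n⌋₊ = N := by
  have h2 : (N : ℝ) / μ ≤ ⌈(N : ℝ) / μ⌉₊ := Nat.le_ceil _
  have h3 : (⌈(N : ℝ) / μ⌉₊ : ℝ) < N / μ + 1 := Nat.ceil_lt_add_one (by positivity)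
  refine ⟨⌈(N : ℝ) / μ⌉₊, ?_, ?_⟩
  · have h4 : (N : ℝ) ≤ N / μ := by
      rw [le_div_iff₀ h0]
      exact mul_le_of_le_one_right (by positivity) h1
    exact_mod_cast h4.trans h2
  · rw [Nat.floor_eq_iff (by positivity)]
    have h5 : μ * (N / μ) = N := by field_simp
    have h6 := mul_le_mul_of_nonneg_left h2 h0.le
    have h7 := mul_lt_mul_of_pos_left h3 h0
    constructor <;> linarith

theorem isUniqueDigits_alternatingDigits {α : ℝ} (h0 : 0 < α) (h2 : α < 1 / 2)
    (h : α ≤ 1 - α / (1 - α)) (hμ0 : 0 ≤ μ) (hμ1 : μ ≤ 1) :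
    IsUniqueDigits α (alternatingDigits μ) := by
  have h1 : α < 1 := by linarith
  refine isUniqueDigits_of_abs_digitSum_lt h0 h1 (abs_alternatingDigits_le μ) fun n => ?_
  rcases hμ0.eq_or_lt with rfl | hμ
  -- For μ = 0 the parity never changes, but all digits vanish.
  · simpa [alternatingDigits, floorParity, digitSum] using tail_ratio_lt_one h2
  · refine (abs_digitSum_sub_shift_lt h0 h1 (floorParity_mem μ) (fun m => ?_) (fun m => ?_)
      (n + 1)).trans_le h
    · obtain ⟨j, hj, hj'⟩ := exists_floor_mul_eq hμ hμ1 (2 * m)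
      exact ⟨j, by omega, by simp [floorParity, hj']⟩
    · obtain ⟨j, hj, hj'⟩ := exists_floor_mul_eq hμ hμ1 (2 * m + 1)
      refine ⟨j, by omega, ?_⟩
      rw [floorParity, hj']
      omega

/-- As μ ≤ 1, the floor grows by 0 or 1 at each step, and its parity flips exactly when it grows. -/
theorem card_zeros_alternatingDigits (hμ0 : 0 ≤ μ) (hμ1 : μ ≤ 1) (n : ℕ) :
    ((Finset.range n).filter (fun i => alternatingDigits μ i = 0)).card + ⌊μ * n⌋₊ = n := by
  induction n with
  | zero => simp
  | succ n ih =>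
    have h3 : ⌊μ * n⌋₊ ≤ ⌊μ * (n + 1 : ℕ)⌋₊ := Nat.floor_le_floor (by push_cast; linarith)
    have h4 : ⌊μ * (n + 1 : ℕ)⌋₊ ≤ ⌊μ * n⌋₊ + 1 := by
      rw [← Nat.floor_add_one (by positivity)]
      exact Nat.floor_le_floor (by push_cast; linarith)
    have h5 : alternatingDigits μ n
        = ((⌊μ * (n + 1 : ℕ)⌋₊ % 2 : ℕ) : ℤ) - ((⌊μ * n⌋₊ % 2 : ℕ) : ℤ) := rfl
    rw [Finset.range_add_one, Finset.filter_insert]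
    split_ifs with hz
    · rw [Finset.card_insert_of_notMem (by simp)]
      omega
    · omega

theorem lowerZeroFreq_alternatingDigits (hμ0 : 0 ≤ μ) (hμ1 : μ ≤ 1) :
    lowerZeroFreq (alternatingDigits μ) = 1 - μ := by
  refine Filter.Tendsto.liminf_eq ?_
  have h := ((tendsto_nat_floor_mul_div_atTop hμ0).comp
    (tendsto_natCast_atTop_atTop (R := ℝ))).const_sub 1
  refine h.congr' ?_
  filter_upwards [Filter.eventually_gt_atTop 0] with n hn
  have hn' : (n : ℝ) ≠ 0 := by positivity
  have h2 : (((Finset.range n).filter (fun i => alternatingDigits μ i = 0)).card : ℝ)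
      + ⌊μ * n⌋₊ = n := by exact_mod_cast card_zeros_alternatingDigits hμ0 hμ1 n
  rw [eq_div_iff hn', Function.comp_apply, sub_mul, one_mul, div_mul_cancel₀ _ hn']
  linarith

theorem dimSet_eq_Icc {α : ℝ} (h0 : 0 < α) (h2 : α < 1 / 2) (h : α ≤ 1 - α / (1 - α)) :
    dimSet α = Set.Icc 0 (ENNReal.ofReal (Real.log 2 / -Real.log α)) := by
  refine (dimSet_subset h0 h2).antisymm fun x hx => (mem_dimSet_iff h0 h2).2 ?_
  have hc := dim_bound_pos h0 (by linarith)
  have hxtop : x ≠ ⊤ := ne_top_of_le_ne_top ENNReal.ofReal_ne_top hx.2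
  have hle : x.toReal ≤ Real.log 2 / -Real.log α := ENNReal.toReal_le_of_le_ofReal hc.le hx.2
  have hr0 : 0 ≤ x.toReal / (Real.log 2 / -Real.log α) := div_nonneg ENNReal.toReal_nonneg hc.le
  have hr1 : x.toReal / (Real.log 2 / -Real.log α) ≤ 1 := div_le_one_of_le₀ hle hc.le
  refine ⟨alternatingDigits (1 - x.toReal / (Real.log 2 / -Real.log α)),
    isUniqueDigits_alternatingDigits h0 h2 h (by linarith) (by linarith), ?_⟩
  rw [lowerZeroFreq_alternatingDigits (by linarith) (by linarith), sub_sub_cancel,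
    div_mul_cancel₀ _ hc.ne', ENNReal.ofReal_toReal hxtop]

end AlternatingDigits

/-! ### Large α: nonzero digits recur -/

section LargeRatio

variable {α : ℝ} {d : ℕ → ℤ} {K : ℕ}

theorem IsUniqueDigits.exists_next_of_eq_one (h : IsUniqueDigits α d) (h3 : 1 / 3 ≤ α)
    (h2 : α < 1 / 2) (hK : α ^ K * (α / (1 - α)) < 1 - (1 - α / (1 - α)) / α) {m : ℕ}
    (hm : d (m + 1) = 1) (hm' : d m ≤ 0) :
    ∃ j < K, d (j + (m + 2)) ≠ 0 ∧ d (j + (m + 2)) ≠ d (j + (m + 1)) := by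
  have h0 : 0 < α := by linarith
  have h1 : α < 1 := by linarith
  have hM := tail_ratio_lt_one h2
  have hT := h.digitSum_lt h3 h1 hm'
  -- The tail T after the 1 satisfies 1 + T < (1 - M)/α; K zeros in a row would make |T| too small.
  rw [digitSum_succ h0.le h1 h.1 (m + 1), hm, ← lt_div_iff₀' h0] at hT
  push_cast at hT
  have hex : ∃ j, j < K ∧ d (j + (m + 2)) ≠ 0 := by
    by_contra! hc
    have h4 := (abs_le.1 (abs_digitSum_le_of_eq_zero h0.le h1 (fun i => h.1 (i + (m + 1 + 1)))
      hc)).1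
    linarith
  classical
  obtain ⟨hjK, hj0⟩ := Nat.find_spec hex
  refine ⟨Nat.find hex, hjK, hj0, fun heq => ?_⟩
  rcases Nat.eq_zero_or_pos (Nat.find hex) with hj | hj
  · rw [hj, zero_add, zero_add, hm] at heq
    rw [digitSum_succ h0.le h1 h.1 (m + 1 + 1), show d (m + 1 + 1) = 1 from heq] at hT
    have h4 := (abs_le.1 (abs_digitSum_le h0.le h1 fun i => h.1 (i + (m + 1 + 1 + 1)))).1
    have h5 : 0 ≤ α * (((1 : ℤ) : ℝ) + digitSum α (fun i => d (i + (m + 1 + 1 + 1)))) :=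
      mul_nonneg h0.le (by push_cast; linarith)
    have h6 : 0 ≤ α ^ K * (α / (1 - α)) :=
      mul_nonneg (by positivity) (div_nonneg h0.le (by linarith))
    exact (hT.trans (sub_pos.1 (h6.trans_lt hK))).not_ge (le_add_of_nonneg_right h5)
  · refine Nat.find_min hex (Nat.sub_lt hj one_pos) ⟨by omega, ?_⟩
    rw [show Nat.find hex - 1 + (m + 2) = Nat.find hex + (m + 1) by omega, ← heq]
    exact hj0

theorem IsUniqueDigits.exists_next (h : IsUniqueDigits α d) (h3 : 1 / 3 ≤ α)
    (h2 : α < 1 / 2) (hK : α ^ K * (α / (1 - α)) < 1 - (1 - α / (1 - α)) / α) {m : ℕ}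
    (hm : d (m + 1) ≠ 0) (hm' : d (m + 1) ≠ d m) :
    ∃ j < K, d (j + (m + 2)) ≠ 0 ∧ d (j + (m + 2)) ≠ d (j + (m + 1)) := by
  have hdm := abs_le.1 (h.1 m)
  obtain hs | hs | hs : d (m + 1) = -1 ∨ d (m + 1) = 0 ∨ d (m + 1) = 1 :=
    mem_signs_iff.2 (h.1 (m + 1))
  · obtain ⟨j, hj, hj1, hj2⟩ :=
      h.neg.exists_next_of_eq_one h3 h2 hK (m := m) (by simp [hs]) (by omega)
    exact ⟨j, hj, by omega, by omega⟩
  · exact absurd hs hm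
  · exact h.exists_next_of_eq_one h3 h2 hK hs (by omega)

/-- Slide the window: when its witness drops out on the left, `IsUniqueDigits.exists_next` provides
the next one. -/
theorem IsUniqueDigits.exists_nonzero_window (h : IsUniqueDigits α d) (h3 : 1 / 3 ≤ α)
    (h2 : α < 1 / 2) (hK0 : 0 < K) (hK : α ^ K * (α / (1 - α)) < 1 - (1 - α / (1 - α)) / α)
    {m : ℕ} (hm : d (m + 1) ≠ 0) (hm' : d (m + 1) ≠ d m) (n : ℕ) (hn : m ≤ n) :
    ∃ j < K, d (n + j + 1) ≠ 0 ∧ d (n + j + 1) ≠ d (n + j) := by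
  induction n, hn using Nat.le_induction with
  | base => exact ⟨0, hK0, hm, hm'⟩
  | succ n hn ih =>
    obtain ⟨j, hj, hj1, hj2⟩ := ih
    rcases Nat.eq_zero_or_pos j with rfl | hj0
    · obtain ⟨i, hi, hi1, hi2⟩ := h.exists_next h3 h2 hK (m := n) hj1 hj2
      refine ⟨i, hi, ?_⟩
      rw [show n + 1 + i + 1 = i + (n + 2) by omega, show n + 1 + i = i + (n + 1) by omega]
      exact ⟨hi1, hi2⟩
    · refine ⟨j - 1, by omega, ?_⟩
      rw [show n + 1 + (j - 1) = n + j by omega]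
      exact ⟨hj1, hj2⟩

/-- Each block of length K after c loses a zero; the factor 2 leaves room for the initial segment.
-/
theorem lowerZeroFreq_le_of_windows (hK0 : 0 < K) {c : ℕ}
    (h : ∀ n ≥ c, ∃ j < K, d (n + j) ≠ 0) : lowerZeroFreq d ≤ 1 - 1 / (2 * K) := by
  have hcount : ∀ q : ℕ, Nat.count (fun i => d i = 0) (c + K * q) + q ≤ c + K * q := by
    intro q
    induction q with
    | zero => simpa using Nat.count_le (fun i => d i = 0)
    | succ q ih =>
      obtain ⟨j, hj, hj0⟩ := h (c + K * q) (by omega)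
      have hlt : Nat.count (fun i => d (c + K * q + i) = 0) K < K := by
        rw [Nat.count_eq_card_filter_range]
        conv_rhs => rw [← Finset.card_range K]
        exact Finset.card_lt_card (Finset.filter_ssubset.2 ⟨j, Finset.mem_range.2 hj, hj0⟩)
      rw [show c + K * (q + 1) = c + K * q + K by ring, Nat.count_add]
      omega
  by_contra! hlt
  rw [lowerZeroFreq_eq] at hlt
  obtain ⟨N, hN⟩ := Filter.eventually_atTop.1
    (Filter.eventually_lt_of_lt_liminf hlt (isBoundedUnder_ge_zeroFreq d))
  have hq := hcount (N + c + 1)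
  have hKq : N + c + 1 ≤ K * (N + c + 1) := Nat.le_mul_of_pos_left _ hK0
  have h4 := hN (c + K * (N + c + 1)) (by omega)
  have hK1 : (1 : ℝ) ≤ K := by exact_mod_cast hK0
  have hpos : (0 : ℝ) < ((c + K * (N + c + 1) : ℕ) : ℝ) := by
    exact_mod_cast (by omega : 0 < c + K * (N + c + 1))
  rw [zeroFreq, ← Nat.count_eq_card_filter_range, lt_div_iff₀ hpos, sub_mul, one_mul,
    one_div_mul_eq_div] at h4
  have hq' : (Nat.count (fun i => d i = 0) (c + K * (N + c + 1)) : ℝ) + (N + c + 1)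
      ≤ ((c + K * (N + c + 1) : ℕ) : ℝ) := by exact_mod_cast hq
  have h5 : ((c + K * (N + c + 1) : ℕ) : ℝ) / (2 * K) ≤ N + c + 1 := by
    rw [div_le_iff₀ (by positivity)]
    push_cast
    have hc0 : (0 : ℝ) ≤ c := by positivity
    have hN0 : (0 : ℝ) ≤ N := by positivity
    nlinarith
  linarith

theorem lowerZeroFreq_eq_zero_of_ne_zero (h : ∀ i, d i ≠ 0) : lowerZeroFreq d = 0 := by
  simp [lowerZeroFreq, h]

theorem lowerZeroFreq_eq_one_of_eventually_zero {N : ℕ} (h : ∀ n ≥ N, d n = 0) :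
    lowerZeroFreq d = 1 := by
  refine Filter.Tendsto.liminf_eq (f := Filter.atTop) (u := zeroFreq d) ?_
  have ht : Filter.Tendsto (fun n : ℕ => 1 - (N : ℝ) / n) Filter.atTop (nhds 1) := by
    simpa using (tendsto_const_div_atTop_nhds_zero_nat (N : ℝ)).const_sub 1
  refine tendsto_of_tendsto_of_tendsto_of_le_of_le' ht tendsto_const_nhds ?_
    (.of_forall (zeroFreq_le_one d))
  filter_upwards [Filter.eventually_gt_atTop 0] with n hn
  have hn' : (0 : ℝ) < n := by exact_mod_cast hn
  rw [zeroFreq, le_div_iff₀ hn', sub_mul, one_mul, div_mul_cancel₀ _ hn'.ne', sub_le_iff_le_add]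
  have hsub : Finset.range n \ Finset.range N ⊆ (Finset.range n).filter (fun i => d i = 0) := by
    intro i hi
    simp only [Finset.mem_sdiff, Finset.mem_range, not_lt] at hi
    exact Finset.mem_filter.2 ⟨Finset.mem_range.2 hi.1, h i hi.2⟩
  have h4 := Finset.card_le_card hsub
  have h5 := Finset.le_card_sdiff (Finset.range N) (Finset.range n)
  rw [Finset.card_range, Finset.card_range] at h5
  exact_mod_cast (by omega :
    n ≤ ((Finset.range n).filter (fun i => d i = 0)).card + N)

theorem exists_gap_lowerZeroFreq (h3 : 1 / 3 ≤ α) (h2 : α < 1 / 2) (h : 1 - α / (1 - α) < α) :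
    ∃ δ : ℝ, 0 < δ ∧ δ ≤ 1 ∧
      ∀ d, IsUniqueDigits α d → lowerZeroFreq d ∉ Set.Ioo (1 - δ) 1 := by
  have h0 : 0 < α := by linarith
  have hη : 0 < 1 - (1 - α / (1 - α)) / α := by
    rw [sub_pos, div_lt_one h0]
    exact h
  have hev : ∀ᶠ K : ℕ in Filter.atTop,
      α ^ K * (α / (1 - α)) < 1 - (1 - α / (1 - α)) / α := by
    have ht := (tendsto_pow_atTop_nhds_zero_of_lt_one h0.le (by linarith)).mul_const
      (α / (1 - α))
    rw [zero_mul] at ht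
    exact ht.eventually_lt_const hη
  obtain ⟨K, hK, hK0⟩ := (hev.and (Filter.eventually_gt_atTop 0)).exists
  have hK1 : (1 : ℝ) ≤ K := by exact_mod_cast hK0
  have hδ1 : 1 / (2 * (K : ℝ)) ≤ 1 := by
    rw [div_le_one (by positivity)]
    linarith
  refine ⟨1 / (2 * K), by positivity, hδ1, fun d hd hmem => ?_⟩
  by_cases hA : ∃ m, d (m + 1) ≠ 0 ∧ d (m + 1) ≠ d m
  · obtain ⟨m, hm, hm'⟩ := hA
    refine hmem.1.not_ge (lowerZeroFreq_le_of_windows hK0 (c := m + 1) fun n hn => ?_)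
    obtain ⟨j, hj, hj1, -⟩ :=
      hd.exists_nonzero_window h3 h2 hK0 hK hm hm' (n - 1) (by omega)
    refine ⟨j, hj, ?_⟩
    rwa [show n - 1 + j + 1 = n + j by omega] at hj1
  -- No nonzero digit differs from its predecessor, so a zero is followed only by zeros: the
  -- frequency is 1, or 0 if there is no zero.
  · push Not at hA
    by_cases hz : ∃ N, d N = 0
    · obtain ⟨N, hN⟩ := hz
      refine hmem.2.ne (lowerZeroFreq_eq_one_of_eventually_zero (N := N) fun n hn => ?_)
      induction n, hn using Nat.le_induction with
      | base => exact hN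
      | succ n hn ih =>
        by_contra hne
        exact hne ((hA n hne).trans ih)
    · push Not at hz
      have h4 := hmem.1
      rw [lowerZeroFreq_eq_zero_of_ne_zero hz] at h4
      linarith

end LargeRatio

/-- Both sides say α² - 3α + 1 ≥ 0, given α < 1/2. -/
theorem le_one_sub_tail_ratio_iff {α : ℝ} (h2 : α < 1 / 2) :
    α ≤ 1 - α / (1 - α) ↔ α ≤ (3 - Real.sqrt 5) / 2 := by
  have h1 : 0 < 1 - α := by linarith
  have h3 : α ≤ 1 - α / (1 - α) ↔ 5 ≤ (3 - 2 * α) ^ 2 := by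
    rw [le_sub_comm, div_le_iff₀ h1]
    constructor <;> intro h <;> nlinarith
  rw [h3, ← Real.sqrt_le_left (by linarith)]
  constructor <;> intro h <;> linarith

theorem theorem1p2 (α : ℝ) :
    (1 / 3 < α → α ≤ (3 - Real.sqrt 5) / 2 →
      dimSet α = Set.Icc 0 (ENNReal.ofReal (Real.log 2 / -Real.log α))) ∧
    ((3 - Real.sqrt 5) / 2 < α → α < 1 / 2 →
      dimSet α ⊂ Set.Icc 0 (ENNReal.ofReal (Real.log 2 / -Real.log α)) ∧
      ∃ δ : ℝ, 0 < δ ∧ ∀ d ∈ univoqueSeq α, lowerZeroFreq d ∉ Set.Ioo (1 - δ) 1) := by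
  constructor
  · intro h3 hα
    have h5 : (2 : ℝ) < Real.sqrt 5 := Real.lt_sqrt_of_sq_lt (by norm_num)
    have h2 : α < 1 / 2 := by linarith
    exact dimSet_eq_Icc (by linarith) h2 ((le_one_sub_tail_ratio_iff h2).2 hα)
  · intro hα h2
    have h5 : Real.sqrt 5 < 7 / 3 := (Real.sqrt_lt' (by norm_num)).2 (by norm_num)
    have h3 : 1 / 3 ≤ α := by linarith
    have h0 : 0 < α := by linarith
    have h1 : α < 1 := by linarith
    obtain ⟨δ, hδ0, hδ1, hδ⟩ := exists_gap_lowerZeroFreq h3 h2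
      (lt_of_not_ge fun h => hα.not_ge ((le_one_sub_tail_ratio_iff h2).1 h))
    have hc := dim_bound_pos h0 h1
    refine ⟨⟨dimSet_subset h0 h2, fun hsub => ?_⟩, δ, hδ0,
      fun d hd => hδ d ((mem_univoqueSeq_iff h0.le h1).1 hd)⟩
    -- The frequency 1 - δ/2 lies in the gap, and δ ≤ 1 keeps it nonnegative, so `ENNReal.ofReal`
    -- can be cancelled.
    have hmem : ENNReal.ofReal ((1 - δ / 2) * (Real.log 2 / -Real.log α)) ∈
        Set.Icc 0 (ENNReal.ofReal (Real.log 2 / -Real.log α)) :=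
      ⟨bot_le, ENNReal.ofReal_le_ofReal (mul_le_of_le_one_left hc.le (by linarith))⟩
    obtain ⟨d, hd, hdim⟩ := (mem_dimSet_iff h0 h2).1 (hsub hmem)
    rw [ENNReal.ofReal_eq_ofReal_iff (mul_nonneg (by linarith) hc.le)
      (mul_nonneg (lowerZeroFreq_nonneg d) hc.le), mul_left_inj' hc.ne'] at hdim
    exact hδ d hd ⟨by linarith, by linarith⟩
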